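/- Let $X$ (phase space) and $K$ (parameter space) be compact metric spaces with metrics $\rho,\rho_K$, and let $f:[0,\infty)\times X\times K\to X$ be continuous, such that every $f(t,\cdot,k)$ is a homeomorphism of $X$ onto a subset of $X$, $f(0,x,k)=x$ and $f(t,f(t',x,k),k)=f(t+t',x,k)$ for all $t,t'\ge 0$, $x\in X$, $k\in K$. Fix $T>0$. For $\varepsilon>0$, a $(k,x,\varepsilon)$-motion is a (not necessarily continuous) mapping $\varphi:[0,\infty)\to X$ with $\varphi(0)=x$ and $\rho(\varphi(t+\tau),f(\tau,\varphi(t),k))<\varepsilon$ for all $t\ge 0$, $\tau\in[0,T]$. A point $y$ is an $\omega$-limit point of $\varphi$ if $\varphi(t_i)\to y$ for some sequence $t_i\to\infty$. Let $\omega^\varepsilon(x,k)$ be the set of all $\omega$-limit points of all $(k,x,\varepsilon)$-motions, and $\omega^0(x,k)=\bigcap_{\varepsilon>0}\omega^\varepsilon(x,k)$. With $\rho^*(z,P)=\inf_{y\in P}\rho(z,y)$ put, for $\gamma>0$ and a $(k,x,\varepsilon)$-motion $\varphi$, $$\tau_3^\varepsilon(\varphi,\gamma)=\inf\{t\ge 0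 \mid \rho^*(\varphi(t'),\omega^\varepsilon(x,k))<\gamma\ \text{for all}\ t'>t\}.$$ The system possesses $\tau_3^0$-slow relaxations if there are $\gamma>0$ and sequences $\varepsilon_j>0$, $\varepsilon_j\to 0$, $(x_j,k_j)\in X\times K$, and $(k_j,x_j,\varepsilon_j)$-motions $\varphi_j$ such that $\tau_3^{\varepsilon_j}(\varphi_j,\gamma)\to\infty$. It possesses $\omega^0(x,k)$-bifurcations if the set-valued function $(x,k)\mapsto\omega^0(x,k)$ is not lower semicontinuous on $X\times K$, where lower semicontinuity at $(x_0,k_0)$ means $d(\omega^0(x_0,k_0),\omega^0(x,k))\to 0$ as $(x,k)\to(x_0,k_0)$, with $d(p,q)=\sup_{x\in p}\rho^*(x,q)$. **Theorem.** (a) If the system possesses $\tau_3^0$-slow relaxations, then it possesses $\omega^0(x,k)$-bifurcations. (b) If $X$ is connected, then the system possesses $\tau_3^0$-slow relaxations if and only if it possesses $\omega^0(x,k)$-bifurcations. -/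

import Mathlib

open Set Filter Topology
open scoped NNReal ENNReal

/-- A family of semiflows of homeomorphisms on the phase space `X`, depending on a parameter in `K`:
a jointly continuous map `f : [0, ∞) × X × K → X` such that every `f(t, ·, k)` is a homeomorphism of
`X` onto a subset of `X`, `f(0, ·, k) = id` and `f(t, f(t', x, k), k) = f(t + t', x, k)`. -/
structure SemiflowFamily (X K : Type*) [MetricSpace X] [MetricSpace K] where
  /-- the shift over the time `t ≥ 0` -/
  f : ℝ≥0 → X → K → X
  continuous_f : Continuous fun p : ℝ≥0 × X × K => f p.1 p.2.1 p.2.2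
  isEmbedding_f : ∀ t k, IsEmbedding fun x => f t x k
  f_zero : ∀ x k, f 0 x k = x
  f_add : ∀ t t' x k, f t (f t' x k) k = f (t + t') x k

/-- The set of `ω`-limit points of a mapping `φ : [0, ∞) → X` (not assumed continuous). -/
def omegaLimitPoints {X : Type*} [MetricSpace X] (φ : ℝ≥0 → X) : Set X :=
  {y | ∃ t : ℕ → ℝ≥0, Tendsto t atTop atTop ∧ Tendsto (fun i => φ (t i)) atTop (𝓝 y)}

/-- The one-sided proximity `d(p, q) = sup_{x ∈ p} inf_{y ∈ q} ρ(x, y)` of subsets of `X`. -/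
noncomputable def setProximity {X : Type*} [MetricSpace X] (p q : Set X) : ℝ≥0∞ :=
  ⨆ x ∈ p, Metric.infEDist x q

/-- Lower semicontinuity (`d`-continuity) of a set-valued function at a point:
`d(F z₀, F z) → 0` as `z → z₀`. -/
def LowerSemicontAt {Z X : Type*} [TopologicalSpace Z] [MetricSpace X]
    (F : Z → Set X) (z₀ : Z) : Prop :=
  Tendsto (fun z => setProximity (F z₀) (F z)) (𝓝 z₀) (𝓝 0)

namespace SemiflowFamily

variable {X K : Type*} [MetricSpace X] [MetricSpace K]

/-- `φ` is a `(k, x, ε, T)`-motion of the system: `φ(0) = x`, and during any time interval of length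
at most `T` it departs from the true motion by less than `ε`. It need not be continuous. -/
def IsEpsMotion (S : SemiflowFamily X K) (T : ℝ≥0) (k : K) (x : X) (ε : ℝ) (φ : ℝ≥0 → X) : Prop :=
  φ 0 = x ∧ ∀ t τ : ℝ≥0, τ ≤ T → dist (φ (t + τ)) (S.f τ (φ t) k) < ε

/-- `ω^ε(x, k)`: all `ω`-limit points of all `(k, x, ε, T)`-motions. -/
def omegaEps (S : SemiflowFamily X K) (T : ℝ≥0) (ε : ℝ) (x : X) (k : K) : Set X :=
  {y | ∃ φ : ℝ≥0 → X, S.IsEpsMotion T k x ε φ ∧ y ∈ omegaLimitPoints φ}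

/-- `ω⁰(x, k) = ⋂_{ε > 0} ω^ε(x, k)`. -/
def omegaZero (S : SemiflowFamily X K) (T : ℝ≥0) (x : X) (k : K) : Set X :=
  ⋂ (ε : ℝ) (_ : 0 < ε), S.omegaEps T ε x k

/-- The time of final entry of a `(k, x, ε, T)`-motion `φ` into the `γ`-neighbourhood of `ω^ε(x, k)`:
`τ₃^ε(φ, γ) = inf {t ≥ 0 | ρ*(φ(t'), ω^ε(x, k)) < γ for all t' > t}`. -/
noncomputable def tauThree (S : SemiflowFamily X K) (T : ℝ≥0) (ε : ℝ) (x : X) (k : K)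
    (φ : ℝ≥0 → X) (γ : ℝ) : ℝ≥0∞ :=
  ⨅ (t : ℝ≥0) (_ : ∀ t' : ℝ≥0, t < t' →
    Metric.infEDist (φ t') (S.omegaEps T ε x k) < ENNReal.ofReal γ), (t : ℝ≥0∞)

/-- The system possesses `τ₃⁰`-slow relaxations. -/
def HasTauThreeZeroSlowRelaxations (S : SemiflowFamily X K) (T : ℝ≥0) : Prop :=
  ∃ γ : ℝ, 0 < γ ∧ ∃ (ε : ℕ → ℝ) (x : ℕ → X) (k : ℕ → K) (φ : ℕ → ℝ≥0 → X),
    (∀ j, 0 < ε j) ∧ Tendsto ε atTop (𝓝 0) ∧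
    (∀ j, S.IsEpsMotion T (k j) (x j) (ε j) (φ j)) ∧
    Tendsto (fun j => S.tauThree T (ε j) (x j) (k j) (φ j) γ) atTop (𝓝 ∞)

/-- The system possesses `ω⁰(x, k)`-bifurcations: `(x, k) ↦ ω⁰(x, k)` is not lower semicontinuous
on `X × K`. -/
def HasOmegaZeroBifurcations (S : SemiflowFamily X K) (T : ℝ≥0) : Prop :=
  ¬ ∀ z₀ : X × K, LowerSemicontAt (fun z : X × K => S.omegaZero T z.1 z.2) z₀

end SemiflowFamily

/-! Chaining pieces of the flow by small jumps, `y` belongs to `ω⁰(x, k)` iff `y` is reached by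
chains both from `x` and from itself.

(a) Late positions of slow motions accumulate at a point `y` reached from the limit `x` of their
initial points and lying in the global attractor, so `y` has a complete backward orbit. A limit
point `z` of that orbit reaches itself and `y`; lower semicontinuity of `ω⁰` at `z`, applied along
the backward orbit, shows that `y` reaches points arbitrarily close to `z`. Hence `y` reaches itself
and `y ∈ ω⁰(x, k)`, and lower semicontinuity at `(x, k)` contradicts the slowness.

(b) Without slow relaxations true orbits enter the neighbourhoods of the chain recurrent set
uniformly fast, so the global attractor consists of chain recurrent points. For connected `X` it is
connected, hence all its points reach each other, and `ω⁰(x, k)` is the whole attractor, whatever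
`x` is. Uniform attraction makes the attractor lower semicontinuous in `k`. -/

open Metric
open Relation (TransGen)

theorem isPreconnected_iInter_of_directed {X ι : Type*} [TopologicalSpace X] [T2Space X]
    [Nonempty ι] {V : ι → Set X} (hdir : Directed (· ⊇ ·) V) (hcomp : ∀ i, IsCompact (V i))
    (hconn : ∀ i, IsPreconnected (V i)) : IsPreconnected (⋂ i, V i) := by
  have hV : IsCompact (⋂ i, V i) :=
    (hcomp (Classical.arbitrary ι)).of_isClosed_subset
      (isClosed_iInter fun i => (hcomp i).isClosed) (iInter_subset V _)
  refine isPreconnected_closed_iff.2 fun A B hA hB hcover ⟨a, haV, haA⟩ ⟨b, hbV, hbB⟩ => ?_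
  by_contra hdisj
  have hAB : Disjoint ((⋂ i, V i) ∩ A) ((⋂ i, V i) ∩ B) :=
    disjoint_left.2 fun x hxA hxB => hdisj ⟨x, hxA.1, hxA.2, hxB.2⟩
  obtain ⟨U, U', hU, hU', hAU, hBU', hUU'⟩ :=
    SeparatedNhds.of_isCompact_isCompact (hV.inter_right hA) (hV.inter_right hB) hAB
  obtain ⟨i, hi⟩ := exists_subset_nhds_of_isCompact hdir hcomp (U := U ∪ U') fun x hx =>
    (hU.union hU').mem_nhds <| (hcover hx).imp (fun h => hAU ⟨hx, h⟩) fun h => hBU' ⟨hx, h⟩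
  obtain ⟨x, -, hxU, hxU'⟩ := hconn i U U' hU hU' hi
    ⟨a, mem_iInter.1 haV i, hAU ⟨haV, haA⟩⟩ ⟨b, mem_iInter.1 hbV i, hBU' ⟨hbV, hbB⟩⟩
  exact disjoint_left.1 hUU' hxU hxU'

theorem exists_seq_of_transGen {α : Type*} {r : α → α → Prop} {x y : α} (h : TransGen r x y) :
    ∃ (n : ℕ) (p : ℕ → α), 0 < n ∧ p 0 = x ∧ p n = y ∧ ∀ i < n, r (p i) (p (i + 1)) := by
  induction h using TransGen.head_induction_on with
  | @single a hay => exact ⟨1, (Nat.casesOn · a fun _ => y), one_pos, rfl, rfl, by simpa⟩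
  | @head a b hab _ ih =>
    obtain ⟨n, p, -, rfl, hpn, hp⟩ := ih
    refine ⟨n + 1, (Nat.casesOn · a p), n.succ_pos, rfl, hpn, fun i hi => ?_⟩
    cases i with
    | zero => exact hab
    | succ i => exact hp i (Nat.lt_of_succ_lt_succ hi)

theorem exists_seq_of_transGen_self {α : Type*} {r : α → α → Prop} {y : α} (h : TransGen r y y) :
    ∃ p : ℕ → α, p 0 = y ∧ (∀ n, r (p n) (p (n + 1))) ∧ ∃ᶠ n in atTop, p n = y := by
  obtain ⟨m, q, hm, hq0, hqm, hq⟩ := exists_seq_of_transGen h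
  refine ⟨fun n => q (n % m), by simpa using hq0, fun n => ?_,
    frequently_atTop.2 fun N => ⟨N * m, Nat.le_mul_of_pos_right N hm, by simpa using hq0⟩⟩
  have hstep := hq (n % m) (Nat.mod_lt n hm)
  rcases (Nat.succ_le_of_lt (Nat.mod_lt n hm)).eq_or_lt with heq | hlt
  · have hmod : (n + 1) % m = 0 := by
      rw [← Nat.mod_add_mod, show n % m + 1 = m from heq, Nat.mod_self]
    rwa [show n % m + 1 = m from heq, hqm, ← hq0, ← hmod] at hstep
  · have hmod : (n + 1) % m = n % m + 1 := by
      rw [← Nat.mod_add_mod, Nat.mod_eq_of_lt hlt]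
    rwa [← hmod] at hstep

theorem exists_seq_of_transGen_of_transGen_self {α : Type*} {r : α → α → Prop} {x y : α}
    (hxy : TransGen r x y) (hyy : TransGen r y y) :
    ∃ p : ℕ → α, p 0 = x ∧ (∀ n, r (p n) (p (n + 1))) ∧ ∃ᶠ n in atTop, p n = y := by
  have prepend : ∀ {a b : α}, r a b →
      (∃ p : ℕ → α, p 0 = b ∧ (∀ n, r (p n) (p (n + 1))) ∧ ∃ᶠ n in atTop, p n = y) →
      ∃ p : ℕ → α, p 0 = a ∧ (∀ n, r (p n) (p (n + 1))) ∧ ∃ᶠ n in atTop, p n = y := by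
    rintro a b hab ⟨p, rfl, hp, hpy⟩
    exact ⟨(Nat.casesOn · a p), rfl, fun n => n.casesOn hab hp,
      (tendsto_add_atTop_nat 1).frequently hpy⟩
  induction hxy using TransGen.head_induction_on with
  | single hay => exact prepend hay (exists_seq_of_transGen_self hyy)
  | head hab _ ih => exact prepend hab ih

theorem tendsto_sum_range_atTop {s : ℕ → ℝ≥0} {c : ℝ≥0} (hc : 0 < c) (hs : ∀ n, c ≤ s n) :
    Tendsto (fun n => ∑ i ∈ Finset.range n, s i) atTop atTop :=
  tendsto_atTop_mono (f := fun n : ℕ => n * c)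
    (fun n => by simpa using Finset.card_nsmul_le_sum (Finset.range n) s c fun i _ => hs i)
    (tendsto_natCast_atTop_atTop.atTop_mul_const hc)

theorem exists_eq_sum_range_add {s : ℕ → ℝ≥0}
    (hs : Tendsto (fun n => ∑ i ∈ Finset.range n, s i) atTop atTop) (u : ℝ≥0) :
    ∃ n, ∃ r < s n, u = ∑ i ∈ Finset.range n, s i + r := by
  obtain ⟨n, hn, hun⟩ := mem_iUnion.1 <| (iUnion_Ico_map_succ_eq_Ici (by simp)
    (not_bddAbove_of_tendsto_atTop hs)).ge (by simp : u ∈ Ici _)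
  obtain ⟨r, rfl⟩ := exists_add_of_le hn
  refine ⟨n, r, ?_, rfl⟩
  rwa [Order.succ_eq_add_one, Finset.sum_range_succ, add_lt_add_iff_left] at hun

theorem exists_piecewise_sum_range {X : Type*} {s : ℕ → ℝ≥0}
    (hs : Tendsto (fun n => ∑ i ∈ Finset.range n, s i) atTop atTop) (g : ℕ → ℝ≥0 → X) :
    ∃ φ : ℝ≥0 → X, ∀ n, ∀ r < s n, φ (∑ i ∈ Finset.range n, s i + r) = g n r := by
  choose N q hq hsum using exists_eq_sum_range_add hs
  refine ⟨fun u => g (N u) (q u), fun n r hr => ?_⟩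
  set u := ∑ i ∈ Finset.range n, s i + r with hu
  have hmono : Monotone fun n => ∑ i ∈ Finset.range n, s i := fun m n hmn =>
    Finset.sum_le_sum_of_subset (Finset.range_mono hmn)
  have hn : N u = n := by
    by_contra hne
    have hmem {m : ℕ} {v w : ℝ≥0} (hw : w = ∑ i ∈ Finset.range m, s i + v) (hv : v < s m) :
        w ∈ Ico (∑ i ∈ Finset.range m, s i) (∑ i ∈ Finset.range (Order.succ m), s i) := by
      rw [hw, Order.succ_eq_add_one, Finset.sum_range_succ]
      exact ⟨le_self_add, by rwa [add_lt_add_iff_left]⟩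
    exact disjoint_left.1 (hmono.pairwise_disjoint_on_Ico_succ hne) (hmem (hsum u) (hq u))
      (hmem hu hr)
  have hqr : q u = r := by
    have h := hsum u
    rwa [hn, hu, add_right_inj, eq_comm] at h
  simp only [hn, hqr]

theorem lowerSemicontAt_iff {Z X : Type*} [TopologicalSpace Z] [MetricSpace X] {F : Z → Set X}
    {z₀ : Z} :
    LowerSemicontAt F z₀ ↔ ∀ γ : ℝ, 0 < γ → ∀ᶠ z in 𝓝 z₀, F z₀ ⊆ thickening γ (F z) := by
  refine ⟨fun h γ hγ => ?_, fun h => ENNReal.tendsto_nhds_zero.2 fun c hc => ?_⟩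
  · filter_upwards [h.eventually (gt_mem_nhds (ENNReal.ofReal_pos.2 hγ))] with z hz y hy
    exact (le_iSup₂ (f := fun x _ => infEDist x (F z)) y hy).trans_lt hz
  · obtain ⟨γ, hγ, hγc⟩ := ENNReal.lt_iff_exists_nnreal_btwn.1 hc
    filter_upwards [h γ (by exact_mod_cast hγ)] with z hz
    refine (iSup₂_le fun y hy => ?_).trans hγc.le
    simpa only [ENNReal.ofReal_coe_nnreal] using (mem_thickening_iff_infEDist_lt.1 (hz hy)).le

theorem exists_tendsto_hyperfilter {X : Type*} [TopologicalSpace X] [CompactSpace X] (u : ℕ → X) :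
    ∃ x, Tendsto u (hyperfilter ℕ) (𝓝 x) :=
  ⟨_, ((hyperfilter ℕ).map u).le_nhds_lim⟩

namespace SemiflowFamily

variable {X K : Type*} [MetricSpace X] [MetricSpace K] {S : SemiflowFamily X K} {T : ℝ≥0} {k : K}
  {x y z : X} {ε ε' η δ δ' : ℝ} {φ : ℝ≥0 → X}

theorem continuous_flow (S : SemiflowFamily X K) (t : ℝ≥0) (k : K) :
    Continuous fun x => S.f t x k :=
  (S.isEmbedding_f t k).continuous

theorem exists_forall_dist_flow_lt [CompactSpace X] (S : SemiflowFamily X K) (A : ℝ≥0) (k : K)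
    (hε : 0 < ε) : ∃ δ > 0, ∀ s ≤ A, ∀ x x' k', dist x x' < δ → dist k k' < δ →
      dist (S.f s x k) (S.f s x' k') < ε := by
  have hcomp : IsCompact (Icc 0 A ×ˢ (univ : Set X) ×ˢ {k}) :=
    isCompact_Icc.prod (isCompact_univ.prod isCompact_singleton)
  obtain ⟨δ, hδ, h⟩ := mem_uniformity_dist.1 <| hcomp.uniformContinuousAt_of_continuousAt
    (fun p : ℝ≥0 × X × K => S.f p.1 p.2.1 p.2.2) (fun p _ => S.continuous_f.continuousAt)
    (dist_mem_uniformity hε)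
  refine ⟨δ, hδ, fun s hs x x' k' hx hk => ?_⟩
  exact h (a := (s, x, k)) (b := (s, x', k')) (by simp [Prod.dist_eq, hx, hk]) (by simp [hs])

theorem IsEpsMotion.mono (h : S.IsEpsMotion T k x ε φ) (hε : ε ≤ ε') : S.IsEpsMotion T k x ε' φ :=
  ⟨h.1, fun t τ hτ => (h.2 t τ hτ).trans_le hε⟩

theorem IsEpsMotion.shift (h : S.IsEpsMotion T k x ε φ) (a : ℝ≥0) :
    S.IsEpsMotion T k (φ a) ε fun t => φ (a + t) :=
  ⟨congrArg φ (add_zero a), fun t τ hτ => by simpa only [add_assoc] using h.2 (a + t) τ hτ⟩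

theorem isEpsMotion_orbit (S : SemiflowFamily X K) (T : ℝ≥0) (k : K) (x : X) (hε : 0 < ε) :
    S.IsEpsMotion T k x ε fun t => S.f t x k :=
  ⟨S.f_zero x k, fun t τ _ => by rwa [S.f_add, add_comm τ t, dist_self]⟩

theorem exists_forall_isEpsMotion_nsmul [CompactSpace X] (S : SemiflowFamily X K) (T : ℝ≥0) (k : K)
    (hη : 0 < η) (n : ℕ) : ∃ ε > 0, ∀ k' x φ, dist k k' < ε → S.IsEpsMotion T k' x ε φ →
      S.IsEpsMotion (n • T) k x η φ := by
  induction n generalizing η with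
  | zero =>
    refine ⟨1, one_pos, fun k' x φ _ h => ⟨h.1, fun t τ hτ => ?_⟩⟩
    obtain rfl : τ = 0 := le_zero_iff.1 (by simpa using hτ)
    simpa [S.f_zero] using hη
  | succ n ih =>
    obtain ⟨δ, hδ, hflow⟩ := S.exists_forall_dist_flow_lt T k (half_pos hη)
    obtain ⟨ε, hε, hmotion⟩ := ih (lt_min hδ hη)
    refine ⟨min ε (min δ (η / 2)), by positivity, fun k' x φ hk h => ⟨h.1, fun t τ hτ => ?_⟩⟩
    obtain ⟨hkε, hkδ, -⟩ : dist k k' < ε ∧ dist k k' < δ ∧ dist k k' < η / 2 := by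
      simpa only [lt_min_iff] using hk
    have hn := (hmotion k' x φ hkε (h.mono (min_le_left _ _))).2 t
    rcases le_total τ (n • T) with hτn | hτn
    · exact (hn τ hτn).trans_le (min_le_right _ _)
    · obtain ⟨r, rfl⟩ := exists_add_of_le hτn
      have hr : r ≤ T := by
        rwa [succ_nsmul, add_le_add_iff_left] at hτ
      have hfar : dist (φ (t + n • T + r)) (S.f r (φ (t + n • T)) k') < η / 2 :=
        (h.2 _ r hr).trans_le ((min_le_right _ _).trans (min_le_right _ _))
      have hnear : dist (S.f r (S.f (n • T) (φ t) k) k) (S.f r (φ (t + n • T)) k') < η / 2 :=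
        hflow r hr _ _ k'
          (by rw [dist_comm]; exact (hn _ le_rfl).trans_le (min_le_left _ _)) hkδ
      rw [S.f_add, add_comm r] at hnear
      rw [← add_assoc]
      exact (dist_triangle_right _ _ _).trans_lt (add_halves η ▸ add_lt_add hfar hnear)

theorem exists_forall_isEpsMotion [CompactSpace X] (S : SemiflowFamily X K) (hT : 0 < T) (A : ℝ≥0)
    (k : K) (hη : 0 < η) : ∃ ε > 0, ∀ k' x φ, dist k k' < ε → S.IsEpsMotion T k' x ε φ →
      S.IsEpsMotion A k x η φ := by
  obtain ⟨n, hn⟩ := Archimedean.arch A hT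
  obtain ⟨ε, hε, h⟩ := S.exists_forall_isEpsMotion_nsmul T k hη n
  exact ⟨ε, hε, fun k' x φ hk hφ =>
    ⟨hφ.1, fun t τ hτ => (h k' x φ hk hφ).2 t τ (hτ.trans hn)⟩⟩

/-- The mappings `φ j` become true motions for the parameter `k` as `j` runs along `l`: on every
time interval of bounded length they follow the flow with an error tending to zero, uniformly in the
position of the interval. No period `T` enters, which is why time shifts, limits of parameters and
long horizons are all handled through this notion. -/
def IsAsymptoticMotion {ι : Type*} (S : SemiflowFamily X K) (k : K) (l : Filter ι)
    (φ : ι → ℝ≥0 → X) : Prop :=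
  ∀ (A : ℝ≥0) (η : ℝ), 0 < η → ∀ᶠ j in l, S.IsEpsMotion A k (φ j 0) η (φ j)

section AsymptoticMotion

variable {ι : Type*} {l : Filter ι} {φ : ι → ℝ≥0 → X}

theorem IsAsymptoticMotion.of_isEpsMotion [CompactSpace X] (hT : 0 < T) {ε : ι → ℝ} {x : ι → X}
    {κ : ι → K} (hε : Tendsto ε l (𝓝 0)) (hκ : Tendsto κ l (𝓝 k))
    (h : ∀ j, S.IsEpsMotion T (κ j) (x j) (ε j) (φ j)) : S.IsAsymptoticMotion k l φ := by
  intro A η hη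
  obtain ⟨ε₀, hε₀, hmotion⟩ := S.exists_forall_isEpsMotion hT A k hη
  filter_upwards [hε.eventually_lt_const hε₀, hκ.eventually (ball_mem_nhds k hε₀)] with j hj hκj
  rw [(h j).1]
  exact hmotion (κ j) (x j) (φ j) (mem_ball'.1 hκj) ((h j).mono hj.le)

theorem IsAsymptoticMotion.shift (h : S.IsAsymptoticMotion k l φ) (a : ι → ℝ≥0) :
    S.IsAsymptoticMotion k l fun j t => φ j (a j + t) := fun A η hη => by
  simpa only [add_zero] using (h A η hη).mono fun j hj => hj.shift (a j)

theorem isAsymptoticMotion_orbit (S : SemiflowFamily X K) (k : K) (l : Filter ι) (x : ι → X) :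
    S.IsAsymptoticMotion k l fun j t => S.f t (x j) k := fun A η hη =>
  .of_forall fun j => by simpa only [S.f_zero] using S.isEpsMotion_orbit A k (x j) hη

theorem IsAsymptoticMotion.tendsto_dist (h : S.IsAsymptoticMotion k l φ) (a : ι → ℝ≥0) (s : ℝ≥0) :
    Tendsto (fun j => dist (φ j (a j + s)) (S.f s (φ j (a j)) k)) l (𝓝 0) :=
  tendsto_order.2 ⟨fun _ hc => .of_forall fun _ => hc.trans_le dist_nonneg,
    fun η hη => (h s η hη).mono fun j hj => hj.2 (a j) s le_rfl⟩

theorem IsAsymptoticMotion.tendsto_flow (h : S.IsAsymptoticMotion k l φ)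
    (hx : Tendsto (fun j => φ j 0) l (𝓝 x)) (s : ℝ≥0) :
    Tendsto (fun j => φ j s) l (𝓝 (S.f s x k)) := by
  have hdist := h.tendsto_dist 0 s
  simp only [Pi.zero_apply, zero_add, dist_comm (φ _ s)] at hdist
  exact (((S.continuous_flow s k).tendsto x).comp hx).congr_dist hdist

end AsymptoticMotion

/-- One step of a `δ`-chain: `y` lies within `δ` of a true position of `x` after some time between
`T` and `2 * T`. The lower bound keeps chains from standing still; the upper one makes the flow
uniformly continuous along a step. -/
def ChainStep (S : SemiflowFamily X K) (T : ℝ≥0) (k : K) (δ : ℝ) (x y : X) : Prop :=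
  ∃ s ∈ Icc T (2 * T), dist y (S.f s x k) < δ

/-- `y` is reached from `x` by `δ`-chains with arbitrarily small `δ`. -/
def ChainReach (S : SemiflowFamily X K) (T : ℝ≥0) (k : K) (x y : X) : Prop :=
  ∀ δ : ℝ, 0 < δ → TransGen (S.ChainStep T k δ) x y

/-- The points that return to themselves by `δ`-chains with arbitrarily small `δ`. -/
def chainRecurrentSet (S : SemiflowFamily X K) (T : ℝ≥0) (k : K) : Set X :=
  {y | S.ChainReach T k y y}

theorem ChainStep.mono (hδ : δ ≤ δ') (h : S.ChainStep T k δ x y) : S.ChainStep T k δ' x y :=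
  h.imp fun _ hs => ⟨hs.1, hs.2.trans_le hδ⟩

theorem transGen_chainStep_of_dist_right (h : TransGen (S.ChainStep T k δ) x y)
    (hz : dist z y < η) : TransGen (S.ChainStep T k (δ + η)) x z := by
  have hη : δ ≤ δ + η := le_add_of_nonneg_right (dist_nonneg.trans hz.le)
  obtain ⟨b, hxb, s, hs, hby⟩ := Relation.TransGen.tail'_iff.1 h
  exact .tail' (Relation.ReflTransGen.mono (fun _ _ => ChainStep.mono hη) _ _ hxb)
    ⟨s, hs, (dist_triangle z y _).trans_lt (add_comm η δ ▸ add_lt_add hz hby)⟩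

theorem transGen_chainStep_of_dist_left (h : TransGen (S.ChainStep T k δ) x y)
    (hz : ∀ s ≤ 2 * T, dist (S.f s x k) (S.f s z k) < η) :
    TransGen (S.ChainStep T k (δ + η)) z y := by
  have hη : δ ≤ δ + η := le_add_of_nonneg_right (dist_nonneg.trans (hz 0 zero_le).le)
  obtain ⟨b, ⟨s, hs, hxb⟩, hby⟩ := Relation.TransGen.head'_iff.1 h
  exact .head' ⟨s, hs, (dist_triangle b _ _).trans_lt (add_lt_add hxb (hz s hs.2))⟩
    (Relation.ReflTransGen.mono (fun _ _ => ChainStep.mono hη) _ _ hby)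

theorem ChainReach.of_tendsto [CompactSpace X] {ι : Type*} {l : Filter ι} [l.NeBot] {u v : ι → X}
    (hu : Tendsto u l (𝓝 x)) (hv : Tendsto v l (𝓝 y))
    (h : ∀ δ > 0, ∀ᶠ j in l, TransGen (S.ChainStep T k δ) (u j) (v j)) :
    S.ChainReach T k x y := by
  intro δ hδ
  obtain ⟨r, hr, hflow⟩ := S.exists_forall_dist_flow_lt (2 * T) k (half_pos (half_pos hδ))
  obtain ⟨j, hchain, huj, hvj⟩ := ((h (δ / 2) (half_pos hδ)).and
    ((hu.eventually (ball_mem_nhds x hr)).and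
      (hv.eventually (ball_mem_nhds y (half_pos (half_pos hδ)))))).exists
  have hxv : TransGen (S.ChainStep T k (δ / 2 + δ / 2 / 2)) x (v j) :=
    transGen_chainStep_of_dist_left hchain fun s hs =>
      hflow s hs _ _ k huj ((dist_self k).trans_lt hr)
  convert transGen_chainStep_of_dist_right hxv (mem_ball'.1 hvj) using 2
  ring

theorem ChainReach.trans (h : S.ChainReach T k x y) (h' : S.ChainReach T k y z) :
    S.ChainReach T k x z := fun δ hδ => (h δ hδ).trans (h' δ hδ)

theorem isClosed_setOf_chainReach [CompactSpace X] (S : SemiflowFamily X K) (T : ℝ≥0) (k : K)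
    (x : X) : IsClosed {y | S.ChainReach T k x y} := by
  refine isSeqClosed_iff_isClosed.1 fun u y hu hy => ?_
  exact .of_tendsto tendsto_const_nhds hy fun δ hδ => .of_forall fun n => hu n δ hδ

theorem isClosed_chainRecurrentSet [CompactSpace X] (S : SemiflowFamily X K) (T : ℝ≥0) (k : K) :
    IsClosed (S.chainRecurrentSet T k) := by
  refine isSeqClosed_iff_isClosed.1 fun u y hu hy => ?_
  exact .of_tendsto hy hy fun δ hδ => .of_forall fun n => hu n δ hδ

theorem isOpen_setOf_transGen_chainStep (S : SemiflowFamily X K) (T : ℝ≥0) (k : K) (δ : ℝ) (x : X) :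
    IsOpen {y | TransGen (S.ChainStep T k δ) x y} := by
  have hballs : {y | TransGen (S.ChainStep T k δ) x y} =
      ⋃ b ∈ {b | Relation.ReflTransGen (S.ChainStep T k δ) x b}, ⋃ s ∈ Icc T (2 * T),
        ball (S.f s b k) δ := by
    ext y
    simp only [Relation.TransGen.tail'_iff, ChainStep, mem_ofPred_eq, mem_iUnion, mem_ball,
      exists_prop]
  rw [hballs]
  exact isOpen_biUnion fun b _ => isOpen_biUnion fun s _ => isOpen_ball

theorem IsEpsMotion.transGen_chainStep (hT : 0 < T) (h : S.IsEpsMotion (2 * T) k x δ φ) {t : ℝ≥0}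
    (ht : T ≤ t) : TransGen (S.ChainStep T k δ) x (φ t) := by
  obtain ⟨n, hn⟩ := Archimedean.arch t hT
  induction n generalizing t with
  | zero => exact absurd (hT.trans_le (ht.trans hn)) (by simp)
  | succ n ih =>
    rcases le_total t (2 * T) with ht2 | ht2
    · refine .single ⟨t, ⟨ht, ht2⟩, ?_⟩
      simpa only [zero_add, h.1] using h.2 0 t ht2
    · obtain ⟨u, rfl⟩ : ∃ u, t = u + T := ⟨t - T, (tsub_add_cancel_of_le ht).symm⟩
      have hu : T ≤ u := by rwa [two_mul, add_le_add_iff_right] at ht2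
      have hun : u ≤ n • T := by rwa [succ_nsmul, add_le_add_iff_right] at hn
      exact (ih hu hun).tail ⟨T, ⟨le_rfl, le_mul_of_one_le_left' one_le_two⟩,
        h.2 u T (le_mul_of_one_le_left' one_le_two)⟩

theorem IsAsymptoticMotion.chainReach [CompactSpace X] (hT : 0 < T) {ι : Type*} {l : Filter ι}
    [l.NeBot] {φ : ι → ℝ≥0 → X} {t : ι → ℝ≥0} (h : S.IsAsymptoticMotion k l φ)
    (hx : Tendsto (fun j => φ j 0) l (𝓝 x)) (ht : ∀ᶠ j in l, T ≤ t j)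
    (hy : Tendsto (fun j => φ j (t j)) l (𝓝 y)) : S.ChainReach T k x y :=
  .of_tendsto hx hy fun δ hδ => ((h (2 * T) δ hδ).and ht).mono fun _ hj =>
    hj.1.transGen_chainStep hT hj.2

theorem chainReach_flow [CompactSpace X] (S : SemiflowFamily X K) (hT : 0 < T) (k : K) (x : X)
    {t : ℝ≥0} (ht : T ≤ t) : S.ChainReach T k x (S.f t x k) := fun _ hδ =>
  (S.isEpsMotion_orbit (2 * T) k x hδ).transGen_chainStep hT ht

theorem exists_isEpsMotion_of_chain [CompactSpace X] (S : SemiflowFamily X K) (hT : 0 < T) (k : K)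
    (hε : 0 < ε) : ∃ δ > 0, ∀ p : ℕ → X, (∀ n, S.ChainStep T k δ (p n) (p (n + 1))) →
      ∃ (φ : ℝ≥0 → X) (t : ℕ → ℝ≥0), S.IsEpsMotion T k (p 0) ε φ ∧ Tendsto t atTop atTop ∧
        ∀ n, φ (t n) = p n := by
  obtain ⟨δ, hδ, hflow⟩ := S.exists_forall_dist_flow_lt T k hε
  refine ⟨δ, hδ, fun p hp => ?_⟩
  choose s hs hsp using hp
  have htop : Tendsto (fun n => ∑ i ∈ Finset.range n, s i) atTop atTop :=
    tendsto_sum_range_atTop hT fun n => (hs n).1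
  obtain ⟨φ, hφ⟩ := exists_piecewise_sum_range htop fun n r => S.f r (p n) k
  have hφp (n : ℕ) : φ (∑ i ∈ Finset.range n, s i) = p n := by
    simpa only [add_zero, S.f_zero] using hφ n 0 (hT.trans_le (hs n).1)
  refine ⟨φ, _, ⟨by simpa using hφp 0, fun u τ hτ => ?_⟩, htop, hφp⟩
  obtain ⟨n, r, hr, rfl⟩ := exists_eq_sum_range_add htop u
  rw [hφ n r hr, S.f_add, add_assoc, add_comm τ]
  rcases lt_or_ge (r + τ) (s n) with hlt | hge
  · rwa [hφ n _ hlt, dist_self]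
  · obtain ⟨q, hq⟩ := exists_add_of_le hge
    have hqτ : q < τ := lt_of_add_lt_add_left (hq ▸ add_lt_add_left hr τ)
    have hqT : q ≤ T := hqτ.le.trans hτ
    rw [hq, ← add_assoc, ← Finset.sum_range_succ,
      hφ (n + 1) q ((hqτ.trans_le hτ).trans_le (hs (n + 1)).1), add_comm (s n), ← S.f_add]
    exact hflow q hqT _ _ k (hsp n) ((dist_self k).trans_lt hδ)

theorem omegaEps_mono (S : SemiflowFamily X K) (T : ℝ≥0) (h : ε ≤ ε') (x : X) (k : K) :
    S.omegaEps T ε x k ⊆ S.omegaEps T ε' x k :=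
  fun _ ⟨φ, hφ, hy⟩ => ⟨φ, hφ.mono h, hy⟩

theorem omegaZero_subset_omegaEps (S : SemiflowFamily X K) (T : ℝ≥0) (hε : 0 < ε) (x : X) (k : K) :
    S.omegaZero T x k ⊆ S.omegaEps T ε x k := iInter₂_subset ε hε

theorem exists_isEpsMotion_of_mem_omegaEps (h : y ∈ S.omegaEps T ε x k) (N : ℝ≥0) :
    ∃ φ, S.IsEpsMotion T k x ε φ ∧ ∃ a b, N ≤ a ∧ N ≤ b ∧
      dist (φ a) y < ε ∧ dist (φ (a + b)) y < ε := by
  obtain ⟨φ, hφ, t, ht, hy⟩ := h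
  have hε : 0 < ε := dist_nonneg.trans_lt (hφ.2 0 0 zero_le)
  have hclose (M : ℝ≥0) : ∃ i, M ≤ t i ∧ dist (φ (t i)) y < ε :=
    ((ht.eventually_ge_atTop M).and (hy.eventually (ball_mem_nhds y hε))).exists
  obtain ⟨i, hNi, hi⟩ := hclose N
  obtain ⟨j, hNj, hj⟩ := hclose (t i + N)
  obtain ⟨c, hc⟩ := exists_add_of_le hNj
  exact ⟨φ, hφ, t i, N + c, hNi, le_self_add, hi, by rwa [← add_assoc, ← hc]⟩

section Limits

variable [CompactSpace X] {ι : Type*} {l : Filter ι} {e : ι → ℝ} {u w : ι → X} {κ : ι → K}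

theorem exists_isAsymptoticMotion_of_mem_omegaEps (hT : 0 < T)
    (hw : ∀ j, w j ∈ S.omegaEps T (e j) (u j) (κ j)) (he : Tendsto e l (𝓝 0))
    (hκ : Tendsto κ l (𝓝 k)) (hy : Tendsto w l (𝓝 y)) (N : ℝ≥0) :
    ∃ (φ : ι → ℝ≥0 → X) (a b : ι → ℝ≥0), S.IsAsymptoticMotion k l φ ∧ (∀ j, φ j 0 = u j) ∧
      (∀ j, N ≤ a j) ∧ (∀ j, N ≤ b j) ∧ Tendsto (fun j => φ j (a j)) l (𝓝 y) ∧
      Tendsto (fun j => φ j (a j + b j)) l (𝓝 y) := by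
  choose φ hφ a b ha hb hwa hwb using fun j => exists_isEpsMotion_of_mem_omegaEps (hw j) N
  have near {v : ι → X} (hv : ∀ j, dist (v j) (w j) < e j) : Tendsto v l (𝓝 y) :=
    hy.congr_dist <| squeeze_zero (fun _ => dist_nonneg)
      (fun j => dist_comm (v j) (w j) ▸ (hv j).le) he
  exact ⟨φ, a, b, .of_isEpsMotion hT he hκ hφ, fun j => (hφ j).1, ha, hb, near hwa, near hwb⟩

theorem mem_chainRecurrentSet_of_tendsto [l.NeBot] (hT : 0 < T)
    (hw : ∀ j, w j ∈ S.omegaEps T (e j) (u j) (κ j)) (he : Tendsto e l (𝓝 0))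
    (hκ : Tendsto κ l (𝓝 k)) (hy : Tendsto w l (𝓝 y)) : y ∈ S.chainRecurrentSet T k := by
  obtain ⟨φ, a, b, hφ, -, -, hb, hya, hyb⟩ :=
    exists_isAsymptoticMotion_of_mem_omegaEps hT hw he hκ hy T
  exact (hφ.shift a).chainReach hT (by simpa only [add_zero] using hya) (.of_forall hb) hyb

end Limits

section OmegaZero

variable [CompactSpace X]

theorem exists_isAsymptoticMotion_of_mem_omegaZero (hT : 0 < T) (h : y ∈ S.omegaZero T x k)
    (N : ℝ≥0) : ∃ (φ : ℕ → ℝ≥0 → X) (a : ℕ → ℝ≥0), S.IsAsymptoticMotion k atTop φ ∧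
      (∀ j, φ j 0 = x) ∧ (∀ j, N ≤ a j) ∧ Tendsto (fun j => φ j (a j)) atTop (𝓝 y) := by
  obtain ⟨φ, a, -, hφ, hφ0, ha, -, hya, -⟩ := exists_isAsymptoticMotion_of_mem_omegaEps hT
    (fun n : ℕ => S.omegaZero_subset_omegaEps T (Nat.one_div_pos_of_nat (n := n)) x k h)
    tendsto_one_div_add_atTop_nhds_zero_nat tendsto_const_nhds tendsto_const_nhds N
  exact ⟨φ, a, hφ, hφ0, ha, hya⟩

theorem chainReach_flow_of_mem_omegaZero (hT : 0 < T) (h : y ∈ S.omegaZero T x k) (s : ℝ≥0) :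
    S.ChainReach T k (S.f s x k) y := by
  obtain ⟨φ, a, hφ, hφ0, ha, hya⟩ := exists_isAsymptoticMotion_of_mem_omegaZero hT h (s + T)
  have has (j : ℕ) : s + (a j - s) = a j := add_tsub_cancel_of_le (le_self_add.trans (ha j))
  refine (hφ.shift fun _ => s).chainReach hT (t := fun j => a j - s) ?_ ?_ ?_
  · simpa only [add_zero] using hφ.tendsto_flow (tendsto_const_nhds.congr fun j => (hφ0 j).symm) s
  · exact .of_forall fun j => le_tsub_of_add_le_left (ha j)
  · simpa only [has] using hya

theorem mem_omegaZero_iff (hT : 0 < T) :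
    y ∈ S.omegaZero T x k ↔ S.ChainReach T k x y ∧ y ∈ S.chainRecurrentSet T k := by
  refine ⟨fun h => ⟨?_, ?_⟩, fun ⟨hxy, hyy⟩ => mem_iInter₂.2 fun ε hε => ?_⟩
  · simpa only [S.f_zero] using chainReach_flow_of_mem_omegaZero hT h 0
  · exact mem_chainRecurrentSet_of_tendsto hT
      (fun n : ℕ => S.omegaZero_subset_omegaEps T (Nat.one_div_pos_of_nat (n := n)) x k h)
      tendsto_one_div_add_atTop_nhds_zero_nat tendsto_const_nhds tendsto_const_nhds
  · obtain ⟨δ, hδ, hmotion⟩ := S.exists_isEpsMotion_of_chain hT k hε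
    obtain ⟨p, rfl, hp, hpy⟩ := exists_seq_of_transGen_of_transGen_self (hxy δ hδ) (hyy δ hδ)
    obtain ⟨φ, t, hφ, ht, hφp⟩ := hmotion p hp
    obtain ⟨σ, hσ, hσy⟩ := extraction_of_frequently_atTop hpy
    refine ⟨φ, hφ, t ∘ σ, ht.comp hσ.tendsto_atTop, tendsto_const_nhds.congr fun i => ?_⟩
    exact (hφp (σ i)).trans (hσy i) |>.symm

theorem mem_omegaZero_self_iff (hT : 0 < T) :
    y ∈ S.omegaZero T y k ↔ y ∈ S.chainRecurrentSet T k :=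
  (mem_omegaZero_iff hT).trans (and_iff_right_of_imp id)

theorem exists_omegaEps_subset_thickening (S : SemiflowFamily X K) (hT : 0 < T) (k : K) {γ : ℝ}
    (hγ : 0 < γ) : ∃ ε > 0, ∀ x, S.omegaEps T ε x k ⊆ thickening γ (S.chainRecurrentSet T k) := by
  by_contra! hfar
  choose u w hw hwfar using fun n : ℕ =>
    (hfar _ (Nat.one_div_pos_of_nat (n := n))).imp fun _ => not_subset.1
  obtain ⟨y, hy⟩ := exists_tendsto_hyperfilter w
  have hrec : y ∈ S.chainRecurrentSet T k := mem_chainRecurrentSet_of_tendsto hT hw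
    (tendsto_one_div_add_atTop_nhds_zero_nat.mono_left Nat.hyperfilter_le_atTop)
    tendsto_const_nhds hy
  obtain ⟨n, hn⟩ := (hy.eventually
    (isOpen_thickening.mem_nhds (self_subset_thickening hγ _ hrec))).exists
  exact hwfar n hn

end OmegaZero

/-- The global attractor of the semiflow with parameter `k`: the points having preimages under all
shifts, equivalently (for compact `X`) the points with a complete backward orbit. -/
def globalAttractor (S : SemiflowFamily X K) (k : K) : Set X :=
  ⋂ t : ℝ≥0, range fun x => S.f t x k

theorem antitone_range_flow (S : SemiflowFamily X K) (k : K) :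
    Antitone fun t : ℝ≥0 => range fun x => S.f t x k := by
  rintro s t hst _ ⟨x, rfl⟩
  exact ⟨S.f (t - s) x k, by simp only [S.f_add, add_tsub_cancel_of_le hst]⟩

section GlobalAttractor

variable [CompactSpace X]

theorem isCompact_range_flow (S : SemiflowFamily X K) (t : ℝ≥0) (k : K) :
    IsCompact (range fun x => S.f t x k) := isCompact_range (S.continuous_flow t k)

theorem IsAsymptoticMotion.mem_range_flow {ι : Type*} {l : Filter ι} [l.NeBot]
    {φ : ι → ℝ≥0 → X} {t : ι → ℝ≥0} (h : S.IsAsymptoticMotion k l φ) {s : ℝ≥0}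
    (ht : ∀ᶠ j in l, s ≤ t j) (hy : Tendsto (fun j => φ j (t j)) l (𝓝 y)) :
    y ∈ range fun x => S.f s x k := by
  have hflow : Tendsto (fun j => S.f s (φ j (t j - s)) k) l (𝓝 y) := by
    refine (hy.congr' ?_).congr_dist (h.tendsto_dist (fun j => t j - s) s)
    filter_upwards [ht] with j hj
    rw [tsub_add_cancel_of_le hj]
  exact (S.isCompact_range_flow s k).isClosed.mem_of_tendsto hflow (.of_forall fun j => ⟨_, rfl⟩)

theorem IsAsymptoticMotion.mem_globalAttractor {ι : Type*} {l : Filter ι} [l.NeBot]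
    {φ : ι → ℝ≥0 → X} {t : ι → ℝ≥0} (h : S.IsAsymptoticMotion k l φ) (ht : Tendsto t l atTop)
    (hy : Tendsto (fun j => φ j (t j)) l (𝓝 y)) : y ∈ S.globalAttractor k :=
  mem_iInter.2 fun s => h.mem_range_flow (ht.eventually_ge_atTop s) hy

theorem chainRecurrentSet_subset_globalAttractor (S : SemiflowFamily X K) (hT : 0 < T) (k : K) :
    S.chainRecurrentSet T k ⊆ S.globalAttractor k := fun _ hy => mem_iInter.2 fun s =>
  have ⟨_, _, hφ, _, ha, hya⟩ :=
    exists_isAsymptoticMotion_of_mem_omegaZero hT ((mem_omegaZero_self_iff hT).2 hy) s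
  hφ.mem_range_flow (.of_forall ha) hya

theorem isPreconnected_globalAttractor [PreconnectedSpace X] (S : SemiflowFamily X K) (k : K) :
    IsPreconnected (S.globalAttractor k) :=
  isPreconnected_iInter_of_directed (S.antitone_range_flow k).directed_ge
    (S.isCompact_range_flow · k) fun t => isPreconnected_range (S.continuous_flow t k)

theorem exists_mem_globalAttractor_chainReach (S : SemiflowFamily X K) (hT : 0 < T) (k : K)
    (x : X) : ∃ z ∈ S.globalAttractor k, S.ChainReach T k x z := by
  obtain ⟨z, hz⟩ := exists_tendsto_hyperfilter fun n : ℕ => S.f n x k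
  have hn : Tendsto (fun n : ℕ => (n : ℝ≥0)) (hyperfilter ℕ) atTop :=
    tendsto_natCast_atTop_atTop.mono_left Nat.hyperfilter_le_atTop
  have horbit := S.isAsymptoticMotion_orbit k (hyperfilter ℕ : Filter ℕ) fun _ => x
  refine ⟨z, horbit.mem_globalAttractor hn hz, horbit.chainReach hT ?_ ?_ hz⟩
  · simp only [S.f_zero, tendsto_const_nhds]
  · exact hn.eventually_ge_atTop T

end GlobalAttractor

-- Injectivity of the shifts makes the preimages of `y` under the different shifts cohere.
theorem exists_backward_orbit (hy : y ∈ S.globalAttractor k) (T : ℝ≥0) :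
    ∃ u : ℕ → X, u 0 = y ∧ ∀ m n, S.f (n • T) (u (m + n)) k = u m := by
  choose u hu using fun n : ℕ => mem_iInter.1 hy (n • T)
  refine ⟨u, by simpa [S.f_zero] using hu 0, fun m n => (S.isEmbedding_f (m • T) k).injective ?_⟩
  simpa only [S.f_add, ← add_nsmul, hu m] using hu (m + n)

theorem le_tauThree {γ : ℝ} {t : ℝ≥0} (h : φ t ∉ thickening γ (S.omegaEps T ε x k)) :
    t ≤ S.tauThree T ε x k φ γ :=
  le_iInf₂ fun _ hs => ENNReal.coe_le_coe.2 <| le_of_not_gt fun hst =>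
    h (mem_thickening_iff_infEDist_lt.2 (hs t hst))

theorem exists_notMem_thickening_of_lt_tauThree {γ : ℝ} {N : ℝ≥0}
    (h : N < S.tauThree T ε x k φ γ) : ∃ t > N, φ t ∉ thickening γ (S.omegaEps T ε x k) := by
  by_contra! hnear
  exact h.not_ge (iInf₂_le N fun t ht => mem_thickening_iff_infEDist_lt.1 (hnear t ht))

theorem hasTauThreeZeroSlowRelaxations_iff :
    S.HasTauThreeZeroSlowRelaxations T ↔ ∃ γ > 0, ∀ η > 0, ∀ N : ℝ≥0, ∃ ε > 0, ε < η ∧ ∃ x k φ,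
      S.IsEpsMotion T k x ε φ ∧ ∃ t > N, φ t ∉ thickening γ (S.omegaEps T ε x k) := by
  constructor
  · rintro ⟨γ, hγ, ε, x, κ, φ, hε, hε0, hφ, hτ⟩
    refine ⟨γ, hγ, fun η hη N => ?_⟩
    obtain ⟨j, hjη, hjN⟩ := ((hε0.eventually_lt_const hη).and
      (hτ.eventually_const_lt (ENNReal.coe_lt_top (r := N)))).exists
    exact ⟨ε j, hε j, hjη, x j, κ j, φ j, hφ j, exists_notMem_thickening_of_lt_tauThree hjN⟩
  · rintro ⟨γ, hγ, h⟩
    choose ε hε hεn x κ φ hφ t ht hfar using fun n : ℕ => h _ (Nat.one_div_pos_of_nat (n := n)) n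
    refine ⟨γ, hγ, ε, x, κ, φ, hε, ?_, hφ, ?_⟩
    · exact squeeze_zero (fun n => (hε n).le) (fun n => (hεn n).le)
        tendsto_one_div_add_atTop_nhds_zero_nat
    · refine tendsto_nhds_top_mono ENNReal.tendsto_nat_nhds_top (.of_forall fun n => ?_)
      exact (ENNReal.coe_le_coe.2 (ht n).le).trans (le_tauThree (hfar n))

section LowerSemicontinuity

variable [CompactSpace X]

theorem mem_chainRecurrentSet_of_lowerSemicontAt (hT : 0 < T)
    (hlsc : ∀ x, LowerSemicontAt (fun z : X × K => S.omegaZero T z.1 z.2) (x, k))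
    (hy : y ∈ S.globalAttractor k) : y ∈ S.chainRecurrentSet T k := by
  obtain ⟨u, hu0, hu⟩ := exists_backward_orbit hy T
  obtain ⟨z, hz⟩ := exists_tendsto_hyperfilter u
  have hback {m n : ℕ} (hmn : m < n) : S.ChainReach T k (u n) (u m) := by
    obtain ⟨i, rfl⟩ := exists_add_of_le hmn.le
    have hi : T ≤ i • T := le_self_nsmul zero_le (by lia)
    exact hu m i ▸ S.chainReach_flow hT k (u (m + i)) hi
  have hzu (m : ℕ) : S.ChainReach T k z (u m) :=
    .of_tendsto hz tendsto_const_nhds fun δ hδ =>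
      (eventually_gt_atTop m).filter_mono Nat.hyperfilter_le_atTop |>.mono fun n hn => hback hn δ hδ
  have hzz : z ∈ S.omegaZero T z k := (mem_omegaZero_self_iff hT).2 <|
    (S.isClosed_setOf_chainReach T k z).mem_of_tendsto hz (.of_forall hzu)
  have hyz : z ∈ closure {w | S.ChainReach T k y w} := by
    refine Metric.mem_closure_iff.2 fun γ hγ => ?_
    have hpair : Tendsto (fun n => (u n, k)) (hyperfilter ℕ) (𝓝 (z, k)) :=
      hz.prodMk_nhds tendsto_const_nhds
    obtain ⟨n, hn⟩ := (hpair.eventually (lowerSemicontAt_iff.1 (hlsc z) γ hγ)).exists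
    obtain ⟨w, hw, hzw⟩ := mem_thickening_iff.1 (hn hzz)
    refine ⟨w, ?_, hzw⟩
    have hyu : S.f (n • T) (u n) k = y := by rw [← hu0, ← hu 0 n, zero_add]
    exact hyu ▸ chainReach_flow_of_mem_omegaZero hT hw (n • T)
  exact ((S.isClosed_setOf_chainReach T k y).closure_subset hyz).trans (hu0 ▸ hzu 0)

theorem HasTauThreeZeroSlowRelaxations.hasOmegaZeroBifurcations [CompactSpace K] (hT : 0 < T)
    (h : S.HasTauThreeZeroSlowRelaxations T) : S.HasOmegaZeroBifurcations T := by
  intro hlsc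
  obtain ⟨γ, hγ, h⟩ := hasTauThreeZeroSlowRelaxations_iff.1 h
  choose ε hε hεn x κ φ hφ t hn hfar using fun n : ℕ => h _ (Nat.one_div_pos_of_nat (n := n)) n
  have hε0 : Tendsto ε atTop (𝓝 0) := squeeze_zero (fun n => (hε n).le) (fun n => (hεn n).le)
    tendsto_one_div_add_atTop_nhds_zero_nat
  have ht : Tendsto t atTop atTop :=
    tendsto_atTop_mono (fun n => (hn n).le) tendsto_natCast_atTop_atTop
  obtain ⟨⟨x₀, k₀⟩, hxk⟩ := exists_tendsto_hyperfilter fun j => (x j, κ j)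
  obtain ⟨y, hy⟩ := exists_tendsto_hyperfilter fun j => φ j (t j)
  have hle := Nat.hyperfilter_le_atTop
  obtain ⟨hx, hκ⟩ := Prod.tendsto_iff _ _ |>.1 hxk
  have hasymp : S.IsAsymptoticMotion k₀ (hyperfilter ℕ : Filter ℕ) φ :=
    .of_isEpsMotion hT (hε0.mono_left hle) hκ hφ
  have hyrec : y ∈ S.chainRecurrentSet T k₀ :=
    mem_chainRecurrentSet_of_lowerSemicontAt hT (fun x => hlsc (x, k₀))
      (hasymp.mem_globalAttractor (ht.mono_left hle) hy)
  have hxy : S.ChainReach T k₀ x₀ y :=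
    hasymp.chainReach hT (by simpa only [(hφ _).1] using hx)
      ((ht.mono_left hle).eventually_ge_atTop T) hy
  obtain ⟨j, hyj, hj⟩ := ((hxk.eventually (lowerSemicontAt_iff.1 (hlsc (x₀, k₀)) _
    (half_pos hγ))).and (hy.eventually (ball_mem_nhds y (half_pos hγ)))).exists
  have hnear : y ∈ thickening (γ / 2) (S.omegaEps T (ε j) (x j) (κ j)) :=
    thickening_subset_of_subset _ (S.omegaZero_subset_omegaEps T (hε j) _ _)
      (hyj ((mem_omegaZero_iff hT).2 ⟨hxy, hyrec⟩))
  refine hfar j (add_halves γ ▸ thickening_thickening_subset _ _ _ ?_)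
  exact mem_thickening_iff.2 ⟨y, hnear, hj⟩

end LowerSemicontinuity

section SlowRelaxations

variable [CompactSpace X]

theorem exists_forall_flow_mem_thickening (hT : 0 < T) (h : ¬S.HasTauThreeZeroSlowRelaxations T)
    {γ : ℝ} (hγ : 0 < γ) :
    ∃ N : ℝ≥0, ∀ t > N, ∀ x k, S.f t x k ∈ thickening γ (S.chainRecurrentSet T k) := by
  by_contra! hfar
  refine h (hasTauThreeZeroSlowRelaxations_iff.2 ⟨γ / 2, half_pos hγ, fun η hη N => ?_⟩)
  obtain ⟨t, ht, x, k, hx⟩ := hfar N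
  obtain ⟨ε, hε, hsub⟩ := S.exists_omegaEps_subset_thickening hT k (half_pos hγ)
  have hε' : 0 < min ε (η / 2) := lt_min hε (half_pos hη)
  refine ⟨min ε (η / 2), hε', (min_le_right _ _).trans_lt (half_lt_self hη), x, k, _,
    S.isEpsMotion_orbit T k x hε', t, ht, fun hmem => hx ?_⟩
  rw [← add_halves γ]
  exact thickening_thickening_subset _ _ _ <| thickening_subset_of_subset _
    ((S.omegaEps_mono T (min_le_left _ _) x k).trans (hsub x)) hmem

theorem globalAttractor_eq_chainRecurrentSet (hT : 0 < T)
    (h : ¬S.HasTauThreeZeroSlowRelaxations T) (k : K) :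
    S.globalAttractor k = S.chainRecurrentSet T k := by
  refine Subset.antisymm (fun y hy => ?_) (S.chainRecurrentSet_subset_globalAttractor hT k)
  rw [← (S.isClosed_chainRecurrentSet T k).closure_eq, closure_eq_iInter_thickening]
  refine mem_iInter₂.2 fun γ hγ => ?_
  obtain ⟨N, hN⟩ := exists_forall_flow_mem_thickening hT h hγ
  obtain ⟨x, rfl⟩ := mem_iInter.1 hy (N + 1)
  exact hN _ (lt_add_one N) x k

theorem chainReach_of_subset_chainRecurrentSet {C : Set X} (hC : IsPreconnected C)
    (hrec : C ⊆ S.chainRecurrentSet T k) (hx : x ∈ C) (hy : y ∈ C) : S.ChainReach T k x y := by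
  intro δ hδ
  refine hC.subset_of_closure_inter_subset (S.isOpen_setOf_transGen_chainStep T k δ x)
    ⟨x, hx, hrec hx δ hδ⟩ (fun z hz => ?_) hy
  obtain ⟨r, hr, hflow⟩ := S.exists_forall_dist_flow_lt (2 * T) k (half_pos hδ)
  obtain ⟨w, hxw, hzw⟩ := Metric.mem_closure_iff.1 hz.1 r hr
  have hwz : TransGen (S.ChainStep T k (δ / 2 + δ / 2)) w z :=
    transGen_chainStep_of_dist_left (hrec hz.2 _ (half_pos hδ)) fun s hs =>
      hflow s hs z w k hzw ((dist_self k).trans_lt hr)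
  exact TransGen.trans hxw (add_halves δ ▸ hwz)

theorem omegaZero_eq_chainRecurrentSet [PreconnectedSpace X] (hT : 0 < T)
    (h : ¬S.HasTauThreeZeroSlowRelaxations T) (x : X) (k : K) :
    S.omegaZero T x k = S.chainRecurrentSet T k := by
  ext y
  rw [mem_omegaZero_iff hT, and_iff_right_iff_imp]
  intro hy
  have hattr := globalAttractor_eq_chainRecurrentSet hT h k
  obtain ⟨z, hz, hxz⟩ := S.exists_mem_globalAttractor_chainReach hT k x
  exact hxz.trans <| chainReach_of_subset_chainRecurrentSet (S.isPreconnected_globalAttractor k)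
    hattr.subset hz (hattr.superset hy)

theorem lowerSemicontAt_chainRecurrentSet (hT : 0 < T) (h : ¬S.HasTauThreeZeroSlowRelaxations T)
    (k : K) : LowerSemicontAt (S.chainRecurrentSet T) k := by
  refine lowerSemicontAt_iff.2 fun γ hγ => ?_
  obtain ⟨N, hN⟩ := exists_forall_flow_mem_thickening hT h (half_pos hγ)
  obtain ⟨δ, hδ, hflow⟩ := S.exists_forall_dist_flow_lt (N + 1) k (half_pos hγ)
  filter_upwards [ball_mem_nhds k hδ] with k' hk' y hy
  obtain ⟨x, rfl⟩ := mem_iInter.1 (S.chainRecurrentSet_subset_globalAttractor hT k hy) (N + 1)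
  have hclose : dist (S.f (N + 1) x k) (S.f (N + 1) x k') < γ / 2 :=
    hflow _ le_rfl x x k' ((dist_self x).trans_lt hδ) (mem_ball'.1 hk')
  rw [← add_halves γ]
  exact thickening_thickening_subset _ _ _
    (mem_thickening_iff.2 ⟨_, hN _ (lt_add_one N) x k', hclose⟩)

theorem HasOmegaZeroBifurcations.hasTauThreeZeroSlowRelaxations [PreconnectedSpace X] (hT : 0 < T)
    (h : S.HasOmegaZeroBifurcations T) : S.HasTauThreeZeroSlowRelaxations T := by
  by_contra hslow
  refine h fun z => ?_
  simp only [omegaZero_eq_chainRecurrentSet hT hslow]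
  exact (lowerSemicontAt_chainRecurrentSet hT hslow z.2).comp (continuous_snd.tendsto z)

end SlowRelaxations

end SemiflowFamily

theorem theorem4p2 {X K : Type*} [MetricSpace X] [CompactSpace X] [MetricSpace K] [CompactSpace K]
    (S : SemiflowFamily X K) (T : ℝ≥0) (hT : 0 < T) :
    (S.HasTauThreeZeroSlowRelaxations T → S.HasOmegaZeroBifurcations T) ∧
    (PreconnectedSpace X →
      (S.HasTauThreeZeroSlowRelaxations T ↔ S.HasOmegaZeroBifurcations T)) :=
  ⟨fun h => h.hasOmegaZeroBifurcations hT, fun _ =>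
    ⟨fun h => h.hasOmegaZeroBifurcations hT, fun h => h.hasTauThreeZeroSlowRelaxations hT⟩⟩
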